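/- Let $w(\rho):=\frac{\rho^2}{(1-\rho^2)^2}$ for $\rho\in(0,1)$ and let $H:=L^2_w(0,1)$ be the complex Hilbert space of (classes of) measurable functions $u:(0,1)\to\mathbb{C}$ with $\int_0^1|u(\rho)|^2w(\rho)\,d\rho<\infty$. Put $p(\rho):=\rho^2$, $q(\rho):=2$ and $$au:=\frac1w\bigl(-(pu')'+qu\bigr),\qquad D(A):=\{u\in H:\ u,\,pu'\in AC_{\mathrm{loc}}(0,1),\ au\in H\},\qquad Au:=au,$$ where $AC_{\mathrm{loc}}(0,1)$ is the space of functions that are absolutely continuous on every compact subinterval of $(0,1)$. Let $f_0(\rho):=2\arctan\rho$ and $$g_0(\rho):=\frac{2(1-\rho^2)\cos(2f_0(\rho))-\rho^2-2(1-\rho^2)^2}{\rho^2},$$ which is bounded on $(0,1)$, and define $A_0:D(A)\subset H\to H$ by $A_0u:=Au+g_0u$. Then the point spectrum of $A_0$ is empty, $\sigma_p(A_0)=\emptyset$: there are no $\lambda\in\mathbb{C}$ and $u\in D(A)$, $u\neq0$, with $A_0u=\lambda u$. -/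

import Mathlib

open MeasureTheory Set

namespace WaveMap

noncomputable section

/-- The weight `w(ρ) = ρ² / (1 - ρ²)²` on `(0, 1)`. -/
def weight (ρ : ℝ) : ℝ := ρ ^ 2 / (1 - ρ ^ 2) ^ 2

/-- The measure `w(ρ) dρ` on the open interval `(0, 1)`. -/
def weightMeasure : Measure ℝ :=
  (volume.restrict (Ioo (0 : ℝ) 1)).withDensity fun ρ => ENNReal.ofReal (weight ρ)

/-- The complex Hilbert space `H = L²_w(0, 1)`. -/
abbrev H : Type := Lp ℂ 2 weightMeasure

/-- `AC_loc(0, 1)`: absolutely continuous on every compact subinterval of `(0, 1)`. -/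
def ACloc (f : ℝ → ℂ) : Prop :=
  ∀ a b : ℝ, 0 < a → a ≤ b → b < 1 → AbsolutelyContinuousOnInterval f a b

/-- `p u'` with `p(ρ) = ρ²`. -/
def quasiDeriv (f : ℝ → ℂ) (ρ : ℝ) : ℂ := (ρ : ℂ) ^ 2 * deriv f ρ

/-- The formal differential expression `a u = (1 / w) (-(p u')' + q u)` with `q = 2`. -/
def slExpr (f : ℝ → ℂ) (ρ : ℝ) : ℂ :=
  ((weight ρ : ℝ) : ℂ)⁻¹ * (-deriv (quasiDeriv f) ρ + 2 * f ρ)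

/-- `u ∈ H`, `u, p u' ∈ AC_loc(0, 1)` and `a u ∈ H`, for an actual function `u`. -/
structure InDomain (f : ℝ → ℂ) : Prop where
  memLp : MemLp f 2 weightMeasure
  ac : ACloc f
  ac_quasiDeriv : ACloc (quasiDeriv f)
  memLp_slExpr : MemLp (slExpr f) 2 weightMeasure

theorem ae_of_forall_mem {P : ℝ → Prop} (h : ∀ ρ ∈ Ioo (0 : ℝ) 1, P ρ) :
    ∀ᵐ ρ ∂weightMeasure, P ρ :=
  (withDensity_absolutelyContinuous _ _).ae_le
    ((ae_restrict_iff' measurableSet_Ioo).2 (ae_of_all _ h))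

theorem ae_of_ae_restrict {P : ℝ → Prop} (h : ∀ᵐ ρ, ρ ∈ Ioo (0 : ℝ) 1 → P ρ) :
    ∀ᵐ ρ ∂weightMeasure, P ρ :=
  (withDensity_absolutelyContinuous _ _).ae_le ((ae_restrict_iff' measurableSet_Ioo).2 h)

theorem weight_pos {ρ : ℝ} (h : ρ ∈ Ioo (0 : ℝ) 1) : 0 < weight ρ := by
  have h1 : 0 < 1 - ρ ^ 2 := by nlinarith [h.1, h.2]
  have h0 := h.1
  unfold weight
  positivity

theorem measurable_weight : Measurable weight := by
  unfold weight
  fun_prop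

theorem restrict_absolutelyContinuous :
    volume.restrict (Ioo (0 : ℝ) 1) ≪ weightMeasure := by
  refine withDensity_absolutelyContinuous' measurable_weight.ennreal_ofReal.aemeasurable ?_
  refine (ae_restrict_iff' measurableSet_Ioo).2 (ae_of_all _ fun ρ h => ?_)
  simpa using weight_pos h

theorem ACloc.continuousOn {f : ℝ → ℂ} (hf : ACloc f) : ContinuousOn f (Ioo 0 1) := by
  intro x hx
  have h := (hf (x / 2) ((x + 1) / 2) (by linarith [hx.1]) (by linarith [hx.1, hx.2])
    (by linarith [hx.2])).continuousOn
  rw [uIcc_of_le (by linarith [hx.1, hx.2])] at h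
  exact (h.continuousAt (Icc_mem_nhds (by linarith [hx.1]) (by linarith [hx.2]))).continuousWithinAt

theorem ACloc.add {f g : ℝ → ℂ} (hf : ACloc f) (hg : ACloc g) : ACloc (f + g) :=
  fun a b h0 hab h1 => (hf a b h0 hab h1).add (hg a b h0 hab h1)

theorem ACloc.smul (c : ℂ) {f : ℝ → ℂ} (hf : ACloc f) : ACloc (c • f) :=
  fun a b h0 hab h1 => (hf a b h0 hab h1).const_smul c

theorem ACloc.congr {f g : ℝ → ℂ} (hf : ACloc f) (h : EqOn f g (Ioo 0 1)) : ACloc g := by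
  intro a b h0 hab h1
  have hfab := hf a b h0 hab h1
  rw [absolutelyContinuousOnInterval_iff] at hfab ⊢
  intro ε hε
  obtain ⟨δ, hδ, hd⟩ := hfab ε hε
  refine ⟨δ, hδ, fun E hE hlt => ?_⟩
  have hsub : uIcc a b ⊆ Ioo 0 1 := by
    rw [uIcc_of_le hab]
    exact fun x hx => ⟨h0.trans_le hx.1, hx.2.trans_lt h1⟩
  convert hd E hE hlt using 1
  refine Finset.sum_congr rfl fun i hi => ?_
  rw [h (hsub (hE.1 i hi).1), h (hsub (hE.1 i hi).2)]

theorem ACloc.ae_differentiableAt {f : ℝ → ℂ} (hf : ACloc f) :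
    ∀ᵐ x, x ∈ Ioo (0 : ℝ) 1 → DifferentiableAt ℝ f x := by
  have key : ∀ n : ℕ, ∀ᵐ x, x ∈ Icc (1 / ((n : ℝ) + 3)) (1 - 1 / ((n : ℝ) + 3)) →
      x ∈ Ioo (1 / ((n : ℝ) + 3)) (1 - 1 / ((n : ℝ) + 3)) → DifferentiableAt ℝ f x := by
    intro n
    have hn : (0 : ℝ) < 1 / ((n : ℝ) + 3) := by positivity
    have hn' : 1 / ((n : ℝ) + 3) ≤ 1 / 3 :=
      one_div_le_one_div_of_le (by norm_num) (by linarith [n.cast_nonneg (α := ℝ)])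
    have hbv := (hf (1 / ((n : ℝ) + 3)) (1 - 1 / ((n : ℝ) + 3)) hn (by linarith)
      (by linarith)).boundedVariationOn
    rw [uIcc_of_le (by linarith)] at hbv
    filter_upwards [hbv.locallyBoundedVariationOn.ae_differentiableWithinAt_of_mem] with x hx h1 h2
    exact (hx h1).differentiableAt (Icc_mem_nhds h2.1 h2.2)
  filter_upwards [ae_all_iff.2 key] with x hx hx01
  obtain ⟨n, hn⟩ := exists_nat_one_div_lt (lt_min hx01.1 (sub_pos.2 hx01.2))
  have hle : 1 / ((n : ℝ) + 3) ≤ 1 / ((n : ℝ) + 1) :=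
    one_div_le_one_div_of_le (by positivity) (by linarith)
  have h1 := hle.trans_lt (hn.trans_le (min_le_left _ _))
  have h2 := hle.trans_lt (hn.trans_le (min_le_right _ _))
  exact hx n ⟨h1.le, by linarith⟩ ⟨h1, by linarith⟩

/-- If `u` and `p u'` are in `AC_loc(0, 1)` then `u` is differentiable everywhere on `(0, 1)`. -/
theorem ACloc.differentiableAt {f : ℝ → ℂ} (hf : ACloc f) (hq : ACloc (quasiDeriv f))
    {x : ℝ} (hx : x ∈ Ioo (0 : ℝ) 1) : DifferentiableAt ℝ f x := by
  have hc : ContinuousOn (deriv f) (Ioo 0 1) := by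
    have h : ContinuousOn (fun ρ : ℝ => ((ρ : ℂ) ^ 2)⁻¹ * quasiDeriv f ρ) (Ioo 0 1) := by
      refine ContinuousOn.mul (ContinuousOn.inv₀ (by fun_prop) fun y hy => ?_) hq.continuousOn
      exact pow_ne_zero 2 (Complex.ofReal_ne_zero.2 hy.1.ne')
    refine h.congr fun y hy => ?_
    have : (y : ℂ) ≠ 0 := Complex.ofReal_ne_zero.2 hy.1.ne'
    simp only [quasiDeriv]
    field_simp
  set a := x / 2 with ha
  set b := (x + 1) / 2 with hb
  have h0a : 0 < a := by linarith [hx.1]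
  have hax : a < x := by linarith [hx.1]
  have hxb : x < b := by linarith [hx.2]
  have hb1 : b < 1 := by linarith [hx.2]
  have hsub : Icc a b ⊆ Ioo 0 1 := fun y hy => ⟨h0a.trans_le hy.1, hy.2.trans_lt hb1⟩
  have hG : ∀ y ∈ Ioo (0 : ℝ) 1, HasDerivAt (fun z => ∫ t in a..z, deriv f t) (deriv f y) y := by
    intro y hy
    refine intervalIntegral.integral_hasDerivAt_right ?_ ?_ (hc.continuousAt (Ioo_mem_nhds hy.1 hy.2))
    · refine (hc.mono fun t ht => ?_).intervalIntegrable
      rcases le_total a y with h | h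
      · rw [uIcc_of_le h] at ht
        exact ⟨h0a.trans_le ht.1, ht.2.trans_lt hy.2⟩
      · rw [uIcc_of_ge h] at ht
        exact ⟨hy.1.trans_le ht.1, ht.2.trans_lt (by linarith)⟩
    · exact hc.stronglyMeasurableAtFilter isOpen_Ioo y hy
  have hGac : AbsolutelyContinuousOnInterval (fun z => ∫ t in a..z, deriv f t) a b := by
    have hcd : ContDiffOn ℝ 1 (fun z => ∫ t in a..z, deriv f t) (Ioo 0 1) := by
      rw [show (1 : WithTop ℕ∞) = 0 + 1 from rfl, contDiffOn_succ_iff_deriv_of_isOpen isOpen_Ioo]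
      refine ⟨fun y hy => (hG y hy).differentiableAt.differentiableWithinAt, by simp, ?_⟩
      exact contDiffOn_zero.2 (hc.congr fun y hy => (hG y hy).deriv)
    exact (hcd.mono (by rw [uIcc_of_le (by linarith)]; exact hsub)).absolutelyContinuousOnInterval
  have hsubac := (hf a b h0a (by linarith) hb1).sub hGac
  obtain ⟨C, hC⟩ := hsubac.const_of_ae_hasDerivAt_zero (by
    filter_upwards [hf.ae_differentiableAt] with y hy hyab
    rw [uIcc_of_le (by linarith)] at hyab
    have := (hy (hsub hyab)).hasDerivAt.sub (hG y (hsub hyab))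
    rwa [sub_self] at this)
  have hEq : f =ᶠ[nhds x] fun z => C + ∫ t in a..z, deriv f t := by
    filter_upwards [Icc_mem_nhds hax hxb] with z hz
    have := hC z (by rw [uIcc_of_le (by linarith)]; exact hz)
    simp only [Pi.sub_apply] at this
    rw [← this]
    ring
  exact (((hG x hx).const_add C).congr_of_eventuallyEq hEq).differentiableAt

theorem InDomain.eqOn {f g : ℝ → ℂ} (hf : InDomain f) (hg : InDomain g)
    (h : f =ᵐ[weightMeasure] g) : EqOn f g (Ioo 0 1) :=
  Measure.eqOn_open_of_ae_eq (restrict_absolutelyContinuous.ae_le h) isOpen_Ioo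
    hf.ac.continuousOn hg.ac.continuousOn

theorem quasiDeriv_congr {f g : ℝ → ℂ} (h : EqOn f g (Ioo 0 1)) :
    EqOn (quasiDeriv f) (quasiDeriv g) (Ioo 0 1) := fun x hx => by
  simp only [quasiDeriv, (h.eventuallyEq_of_mem (Ioo_mem_nhds hx.1 hx.2)).deriv_eq]

theorem slExpr_congr {f g : ℝ → ℂ} (h : EqOn f g (Ioo 0 1)) :
    EqOn (slExpr f) (slExpr g) (Ioo 0 1) := fun x hx => by
  simp only [slExpr, h hx,
    ((quasiDeriv_congr h).eventuallyEq_of_mem (Ioo_mem_nhds hx.1 hx.2)).deriv_eq]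

/-- `a u` depends only on the class of `u` in `H`. -/
theorem InDomain.slExpr_ae_eq {f g : ℝ → ℂ} (hf : InDomain f) (hg : InDomain g)
    (h : f =ᵐ[weightMeasure] g) : slExpr f =ᵐ[weightMeasure] slExpr g :=
  ae_of_forall_mem (slExpr_congr (hf.eqOn hg h))

theorem InDomain.quasiDeriv_add {f g : ℝ → ℂ} (hf : InDomain f) (hg : InDomain g) :
    EqOn (quasiDeriv f + quasiDeriv g) (quasiDeriv (f + g)) (Ioo 0 1) := fun x hx => by
  simp only [quasiDeriv, Pi.add_apply]
  rw [deriv_add (hf.ac.differentiableAt hf.ac_quasiDeriv hx)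
    (hg.ac.differentiableAt hg.ac_quasiDeriv hx)]
  ring

theorem quasiDeriv_smul (c : ℂ) (f : ℝ → ℂ) : quasiDeriv (c • f) = c • quasiDeriv f := by
  funext x
  simp only [quasiDeriv, Pi.smul_apply, smul_eq_mul, deriv_const_smul_field]
  ring

theorem slExpr_smul (c : ℂ) (f : ℝ → ℂ) : slExpr (c • f) = c • slExpr f := by
  funext x
  simp only [slExpr, quasiDeriv_smul, Pi.smul_apply, smul_eq_mul, deriv_const_smul_field]
  ring

theorem InDomain.slExpr_add {f g : ℝ → ℂ} (hf : InDomain f) (hg : InDomain g) :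
    slExpr (f + g) =ᵐ[weightMeasure] slExpr f + slExpr g := by
  refine ae_of_ae_restrict ?_
  filter_upwards [hf.ac_quasiDeriv.ae_differentiableAt, hg.ac_quasiDeriv.ae_differentiableAt]
    with x h1 h2 hx
  simp only [slExpr, Pi.add_apply]
  rw [← ((hf.quasiDeriv_add hg).eventuallyEq_of_mem (Ioo_mem_nhds hx.1 hx.2)).deriv_eq,
    deriv_add (h1 hx) (h2 hx)]
  ring

theorem InDomain.add {f g : ℝ → ℂ} (hf : InDomain f) (hg : InDomain g) : InDomain (f + g) where
  memLp := hf.memLp.add hg.memLp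
  ac := hf.ac.add hg.ac
  ac_quasiDeriv := (hf.ac_quasiDeriv.add hg.ac_quasiDeriv).congr (hf.quasiDeriv_add hg)
  memLp_slExpr := (hf.memLp_slExpr.add hg.memLp_slExpr).ae_eq (hf.slExpr_add hg).symm

theorem InDomain.smul (c : ℂ) {f : ℝ → ℂ} (hf : InDomain f) : InDomain (c • f) where
  memLp := hf.memLp.const_smul c
  ac := hf.ac.smul c
  ac_quasiDeriv := by rw [quasiDeriv_smul]; exact hf.ac_quasiDeriv.smul c
  memLp_slExpr := by rw [slExpr_smul]; exact hf.memLp_slExpr.const_smul c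

theorem inDomain_zero : InDomain 0 := by
  have hq : quasiDeriv 0 = 0 := by simpa using quasiDeriv_smul 0 0
  have hs : slExpr 0 = 0 := by simpa using slExpr_smul 0 0
  have hac : ACloc 0 := fun a b _ _ _ =>
    (contDiffOn_const (c := (0 : ℂ))).absolutelyContinuousOnInterval
  exact ⟨MemLp.zero, hac, by rwa [hq], by rw [hs]; exact MemLp.zero⟩

/-- `D(A) = {u ∈ H : u, p u' ∈ AC_loc(0, 1), a u ∈ H}`. -/
def domainA : Submodule ℂ H where
  carrier := {u | ∃ f : ℝ → ℂ, InDomain f ∧ u =ᵐ[weightMeasure] f}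
  zero_mem' := ⟨0, inDomain_zero, Lp.coeFn_zero _ _ _⟩
  add_mem' := by
    rintro u v ⟨f, hf, hu⟩ ⟨g, hg, hv⟩
    exact ⟨f + g, hf.add hg, (Lp.coeFn_add u v).trans (hu.add hv)⟩
  smul_mem' := by
    rintro c u ⟨f, hf, hu⟩
    exact ⟨c • f, hf.smul c, (Lp.coeFn_smul c u).trans (hu.const_smul c)⟩

/-- The representative of `u ∈ D(A)` with `u, p u' ∈ AC_loc(0, 1)`; it is unique on `(0, 1)`. -/
def rep (u : domainA) : ℝ → ℂ := u.2.choose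

theorem rep_inDomain (u : domainA) : InDomain (rep u) := u.2.choose_spec.1

theorem rep_ae_eq (u : domainA) : (u : H) =ᵐ[weightMeasure] rep u := u.2.choose_spec.2

/-- The operator `A : D(A) ⊂ H → H`, `A u = a u`. -/
def opA : H →ₗ.[ℂ] H where
  domain := domainA
  toFun :=
    { toFun := fun u => (rep_inDomain u).memLp_slExpr.toLp (slExpr (rep u))
      map_add' := fun u v => by
        rw [← MemLp.toLp_add, MemLp.toLp_eq_toLp_iff]
        have h := (rep_inDomain u).add (rep_inDomain v)
        refine ((rep_inDomain (u + v)).slExpr_ae_eq h ?_).trans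
          ((rep_inDomain u).slExpr_add (rep_inDomain v))
        exact (rep_ae_eq (u + v)).symm.trans
          ((Lp.coeFn_add (u : H) v).trans ((rep_ae_eq u).add (rep_ae_eq v)))
      map_smul' := fun c u => by
        rw [RingHom.id_apply, ← MemLp.toLp_const_smul, MemLp.toLp_eq_toLp_iff, ← slExpr_smul]
        refine (rep_inDomain (c • u)).slExpr_ae_eq ((rep_inDomain u).smul c) ?_
        exact (rep_ae_eq (c • u)).symm.trans
          ((Lp.coeFn_smul c (u : H)).trans ((rep_ae_eq u).const_smul c)) }

/-- The Turok--Spergel solution `f₀(ρ) = 2 arctan ρ`. -/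
def f0 (ρ : ℝ) : ℝ := 2 * Real.arctan ρ

/-- `g₀(ρ) = (2 (1 - ρ²) cos (2 f₀(ρ)) - ρ² - 2 (1 - ρ²)²) / ρ²`. -/
def g0 (ρ : ℝ) : ℝ :=
  (2 * (1 - ρ ^ 2) * Real.cos (2 * f0 ρ) - ρ ^ 2 - 2 * (1 - ρ ^ 2) ^ 2) / ρ ^ 2

theorem measurable_g0 : Measurable g0 := by
  unfold g0 f0
  fun_prop

theorem cos_two_f0 (ρ : ℝ) : Real.cos (2 * f0 ρ) = 1 - 8 * ρ ^ 2 / (1 + ρ ^ 2) ^ 2 := by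
  have h : (1 : ℝ) + ρ ^ 2 ≠ 0 := by positivity
  rw [f0, Real.cos_two_mul, Real.cos_two_mul, Real.cos_sq_arctan]
  field_simp
  ring

theorem abs_g0_le {ρ : ℝ} (h : ρ ∈ Ioo (0 : ℝ) 1) : |g0 ρ| ≤ 15 := by
  have h0 : ρ ≠ 0 := h.1.ne'
  have h1 : (1 : ℝ) + ρ ^ 2 ≠ 0 := by positivity
  have e : g0 ρ = 1 - 2 * ρ ^ 2 - 16 * (1 - ρ ^ 2) / (1 + ρ ^ 2) ^ 2 := by
    rw [g0, cos_two_f0]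
    field_simp
    ring
  have hs0 : 0 < ρ ^ 2 := by positivity
  have hs1 : ρ ^ 2 < 1 := by nlinarith [h.1, h.2]
  generalize ρ ^ 2 = s at *
  have hd : (0 : ℝ) < (1 + s) ^ 2 := by positivity
  have e2 : 0 ≤ 16 * (1 - s) / (1 + s) ^ 2 := by
    apply div_nonneg <;> nlinarith
  have e3 : 16 * (1 - s) / (1 + s) ^ 2 ≤ 16 - 2 * s := by
    rw [div_le_iff₀ hd]
    nlinarith [mul_pos hs0 hs0, mul_pos hs0 (mul_pos hs0 hs0),
      mul_pos (mul_pos hs0 hs0) (sub_pos.2 hs1)]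
  rw [e, abs_le]
  constructor <;> linarith

theorem memLp_g0_mul (u : H) : MemLp (fun ρ => (g0 ρ : ℂ) * u ρ) 2 weightMeasure := by
  refine MemLp.of_le_mul (c := 15) (Lp.memLp u) ?_ ?_
  · exact (Complex.measurable_ofReal.comp measurable_g0).aestronglyMeasurable.mul
      (Lp.aestronglyMeasurable u)
  · refine ae_of_forall_mem fun ρ h => ?_
    rw [norm_mul, Complex.norm_real, Real.norm_eq_abs]
    exact mul_le_mul_of_nonneg_right (abs_g0_le h) (norm_nonneg _)

/-- The multiplication operator `u ↦ g₀ u` on `H`. -/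
def mulG0 : H →ₗ[ℂ] H where
  toFun u := (memLp_g0_mul u).toLp _
  map_add' u v := by
    rw [← MemLp.toLp_add, MemLp.toLp_eq_toLp_iff]
    filter_upwards [Lp.coeFn_add u v] with ρ h
    simp only [h, Pi.add_apply, mul_add]
  map_smul' c u := by
    rw [RingHom.id_apply, ← MemLp.toLp_const_smul, MemLp.toLp_eq_toLp_iff]
    filter_upwards [Lp.coeFn_smul c u] with ρ h
    simp only [h, Pi.smul_apply, smul_eq_mul]
    ring

/-- The operator `A₀ : D(A) ⊂ H → H`, `A₀ u = A u + g₀ u`. -/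
def opA0 : H →ₗ.[ℂ] H where
  domain := opA.domain
  toFun := opA.toFun + mulG0 ∘ₗ opA.domain.subtype

/-- The point spectrum of an unbounded operator `T : D(T) ⊂ E → E`: the set of all `μ ∈ ℂ` such
that `T x = μ x` for some nonzero `x ∈ D(T)`. -/
def pointSpectrum {E : Type*} [AddCommGroup E] [Module ℂ E] (T : E →ₗ.[ℂ] E) : Set ℂ :=
  {μ | ∃ x : T.domain, (x : E) ≠ 0 ∧ T x = μ • (x : E)}

end

end WaveMap

namespace WaveMap

open Filter Topology ComplexConjugate

/-! Substituting `ρ = tanh t` and `y t = sinh t * u (tanh t)` preserves the L² norm and turns `A₀ u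
= λ u` into `-y'' + V y = λ y` on `(0, ∞)`. Here `V = h'' / h` for the positive nondecreasing
function `h = sinh² t / cosh 2t`; under the same substitution `h` comes from `√(1 - ρ²) / 2` times
`ρ f₀'(ρ)`, the dilation derivative of `f₀`. With `b = h' / h ≥ 0` the equation factors into `y' = b
y + z`, `z' = -b z - λ y`.

The product `z * conj y` has derivative `|z|² - λ |y|²`. It vanishes at both ends: at `0` because `y
∈ L²` excludes the branch of size `1 / t` (`boundary_at_zero`), at infinity because `z` is square
integrable too (`partner_sq_integrableOn`). Integrating gives `∫ |z|² = λ ∫ |y|²`, so `y ≠ 0` forces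
`λ` to be real and nonnegative (`integral_partner_sq_eq`). No self-adjointness is used.

For such `λ` the function `(|z|² + λ |y|²) h²` is nondecreasing, and integrable since `h ≤ 1`. A
nonnegative function with both properties on a half-line is zero, so `y` vanishes
(`eq_zero_of_nonneg_eigenvalue`). -/

/-! ### The first-order system near the singular end `t = 0`. -/

/-- Since `b = h' / h`, the function `h` is an integrating factor: `b` drops out of the equations
for `h z` and, below, for `y / h`. -/
theorem weighted_partner_hasDerivAt {y z : ℝ → ℂ} {b h : ℝ → ℝ} {lam : ℂ} {t : ℝ}
    (hz : HasDerivAt z (-(b t * z t) - lam * y t) t) (hh : HasDerivAt h (b t * h t) t) :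
    HasDerivAt (fun t => (h t : ℂ) * z t) (-(lam * (h t * y t))) t := by
  refine (hh.ofReal_comp.mul hz).congr_deriv ?_
  push_cast
  ring

theorem quotient_hasDerivAt {y z : ℝ → ℂ} {b h : ℝ → ℝ} {t : ℝ}
    (hy : HasDerivAt y (b t * y t + z t) t) (hh : HasDerivAt h (b t * h t) t) (h0 : h t ≠ 0) :
    HasDerivAt (fun t => y t / h t) (z t / h t) t := by
  have h0' : (h t : ℂ) ≠ 0 := Complex.ofReal_ne_zero.2 h0
  refine (hy.div hh.ofReal_comp h0').congr_deriv ?_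
  push_cast
  field_simp
  ring

theorem integrableOn_Ioc_of_sq {y : ℝ → ℂ} (hc : ContinuousOn y (Ioi 0))
    (hint : IntegrableOn (fun t => ‖y t‖ ^ 2) (Ioi 0)) : IntegrableOn y (Ioc 0 1) := by
  have h1 : IntegrableOn (fun t => ‖y t‖ ^ 2 + 1) (Ioc 0 1) :=
    (hint.mono_set Ioc_subset_Ioi_self).add (integrableOn_const (by simp) (by simp))
  refine Integrable.mono' h1
    ((hc.mono Ioc_subset_Ioi_self).aestronglyMeasurable measurableSet_Ioc) ?_
  exact ae_of_all _ fun t => by nlinarith [sq_nonneg (‖y t‖ - 1)]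

/-- The function `h z` has a limit at `0`, attained at quadratic rate. -/
theorem weighted_partner_sub_le {y z : ℝ → ℂ} {b h : ℝ → ℝ} {lam : ℂ}
    (hyc : ContinuousOn y (Ioi 0)) (hyi : IntegrableOn y (Ioc 0 1))
    (hz : ∀ t > 0, HasDerivAt z (-(b t * z t) - lam * y t) t)
    (hh : ∀ t > 0, HasDerivAt h (b t * h t) t) (hpos : ∀ t > 0, 0 < h t)
    (hup : ∀ t ∈ Ioc (0 : ℝ) 1, h t ≤ t ^ 2) :
    ∃ (N : ℂ) (K : ℝ), 0 ≤ K ∧ ∀ t ∈ Ioc (0 : ℝ) 1, ‖(h t : ℂ) * z t - N‖ ≤ K * t ^ 2 := by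
  set g : ℝ → ℂ := fun t => -(lam * (h t * y t)) with hg
  have hgc : ContinuousOn g (Ioi 0) := by
    have : ContinuousOn h (Ioi 0) := fun t ht => (hh t ht).continuousAt.continuousWithinAt
    have := Complex.continuous_ofReal.comp_continuousOn this
    exact (continuousOn_const.mul (this.mul hyc)).neg
  have hgle : ∀ T ∈ Ioc (0 : ℝ) 1, ∀ t ∈ Ioc 0 T, ‖g t‖ ≤ ‖lam‖ * T ^ 2 * ‖y t‖ := by
    intro T hT t ht
    have h2 : h t ≤ T ^ 2 := (hup t ⟨ht.1, ht.2.trans hT.2⟩).trans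
      (pow_le_pow_left₀ ht.1.le ht.2 2)
    simp only [hg, norm_neg, norm_mul, Complex.norm_real, Real.norm_eq_abs,
      abs_of_pos (hpos t ht.1)]
    nlinarith [mul_le_mul_of_nonneg_left h2 (mul_nonneg (norm_nonneg lam) (norm_nonneg (y t)))]
  have hgi : IntegrableOn g (Ioc 0 1) := by
    refine Integrable.mono' (hyi.norm.const_mul (‖lam‖ * 1 ^ 2))
      ((hgc.mono Ioc_subset_Ioi_self).aestronglyMeasurable measurableSet_Ioc) ?_
    exact (ae_restrict_iff' measurableSet_Ioc).2
      (ae_of_all _ fun t ht => hgle 1 (by simp) t ht)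
  have hgI : ∀ t ∈ Ioc (0 : ℝ) 1, IntervalIntegrable g volume 0 t := fun t ht =>
    (intervalIntegrable_iff_integrableOn_Ioc_of_le ht.1.le).2
      (hgi.mono_set (Ioc_subset_Ioc_right ht.2))
  -- `N` is chosen so that `h z - N` is the integral of `g` from `0` to `t`; the rate `t²` comes
  -- from `h ≤ t²` in that integral.
  refine ⟨h 1 * z 1 - ∫ s in (0 : ℝ)..1, g s, ‖lam‖ * ∫ s in (0 : ℝ)..1, ‖y s‖, ?_, ?_⟩
  · exact mul_nonneg (norm_nonneg _)
      (intervalIntegral.integral_nonneg zero_le_one fun _ _ => norm_nonneg _)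
  intro t ht
  have h01 := hgI 1 (by simp)
  have h0t := hgI t ht
  have ht1 := h0t.symm.trans h01
  have e : ∫ s in t..1, g s = h 1 * z 1 - h t * z t := by
    refine intervalIntegral.integral_eq_sub_of_hasDerivAt (f := fun t => (h t : ℂ) * z t)
      (fun s hs => ?_) ht1
    rw [uIcc_of_le ht.2] at hs
    have hs0 : 0 < s := ht.1.trans_le hs.1
    exact weighted_partner_hasDerivAt (hz s hs0) (hh s hs0)
  have e2 := intervalIntegral.integral_add_adjacent_intervals h0t ht1
  have e3 : (h t : ℂ) * z t - (h 1 * z 1 - ∫ s in (0 : ℝ)..1, g s) = ∫ s in (0 : ℝ)..t, g s := by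
    rw [← e2, e]; ring
  rw [e3]
  have hyI : IntervalIntegrable (fun s => ‖y s‖) volume 0 1 :=
    (intervalIntegrable_iff_integrableOn_Ioc_of_le zero_le_one).2 hyi.norm
  have hyt : IntervalIntegrable (fun s => ‖y s‖) volume 0 t :=
    (intervalIntegrable_iff_integrableOn_Ioc_of_le ht.1.le).2
      (hyi.mono_set (Ioc_subset_Ioc_right ht.2)).norm
  calc ‖∫ s in (0 : ℝ)..t, g s‖ ≤ ∫ s in (0 : ℝ)..t, ‖lam‖ * t ^ 2 * ‖y s‖ :=
        intervalIntegral.norm_integral_le_of_norm_le ht.1.le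
          (ae_of_all _ fun s hs => hgle t ht s hs) (hyt.const_mul _)
    _ = ‖lam‖ * t ^ 2 * ∫ s in (0 : ℝ)..t, ‖y s‖ := intervalIntegral.integral_const_mul _ _
    _ ≤ ‖lam‖ * t ^ 2 * ∫ s in (0 : ℝ)..1, ‖y s‖ := by
        refine mul_le_mul_of_nonneg_left ?_ (by positivity)
        exact intervalIntegral.integral_mono_interval le_rfl ht.1.le ht.2
          (ae_of_all _ fun _ => norm_nonneg _) hyI
    _ = _ := by ring

/-- Integrability of `y` at `0` excludes the singular solution. -/
theorem weighted_partner_limit_eq_zero {y z : ℝ → ℂ} {b h : ℝ → ℝ} {c K : ℝ} {N : ℂ} (hc : 0 < c)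
    (hK : 0 ≤ K) (hyi : IntegrableOn y (Ioc 0 1))
    (hy : ∀ t > 0, HasDerivAt y (b t * y t + z t) t)
    (hh : ∀ t > 0, HasDerivAt h (b t * h t) t) (hpos : ∀ t > 0, 0 < h t)
    (hlow : ∀ t ∈ Ioc (0 : ℝ) 1, c * t ^ 2 ≤ h t)
    (hup : ∀ t ∈ Ioc (0 : ℝ) 1, h t ≤ t ^ 2)
    (hN : ∀ t ∈ Ioc (0 : ℝ) 1, ‖(h t : ℂ) * z t - N‖ ≤ K * t ^ 2) : N = 0 := by
  by_contra hN0
  have hn : 0 < ‖N‖ := norm_pos_iff.2 hN0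
  -- On `(0, T]` the error `K t² ≤ K T` is at most half of `‖N‖`.
  obtain ⟨T, hT0, hT1, hTK⟩ : ∃ T : ℝ, 0 < T ∧ T ≤ 1 ∧ K * T ≤ ‖N‖ / 2 := by
    refine ⟨min 1 (‖N‖ / 2 / (K + 1)), by positivity, min_le_left _ _, ?_⟩
    have h1 : min 1 (‖N‖ / 2 / (K + 1)) ≤ ‖N‖ / 2 / (K + 1) := min_le_right _ _
    have h0 : 0 < min 1 (‖N‖ / 2 / (K + 1)) := by positivity
    rw [le_div_iff₀ (by positivity)] at h1
    nlinarith
  -- There `Re (conj N * z / h) ≥ (‖N‖² / 2) / h² ≥ 3 a / t⁴`, which is minus the derivative of `a /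
  -- t³`. Hence `ψ` below is nondecreasing and `φ` falls to `-∞` at least like `-a / t³` as `t → 0`.
  set a := ‖N‖ ^ 2 / 6 with ha
  have ha0 : 0 < a := by positivity
  let φ : ℝ → ℝ := fun t => (conj N * (y t / h t)).re
  have hφ : ∀ t > 0, HasDerivAt φ (conj N * (z t / h t)).re t := by
    intro t ht
    have := (quotient_hasDerivAt (hy t ht) (hh t ht) (hpos t ht).ne').const_mul (conj N)
    exact Complex.reCLM.hasFDerivAt.comp_hasDerivAt t this
  let ψ : ℝ → ℝ := fun t => φ t + a * (t ^ 3)⁻¹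
  have hψ : ∀ t > 0, HasDerivAt ψ ((conj N * (z t / h t)).re - 3 * a / t ^ 4) t := by
    intro t ht
    refine ((hφ t ht).add
      (((hasDerivAt_pow 3 t).inv (by positivity)).const_mul a)).congr_deriv ?_
    push_cast
    field_simp
    norm_num
    ring
  have hmono : MonotoneOn ψ (Ioc 0 T) := by
    refine monotoneOn_of_hasDerivWithinAt_nonneg (convex_Ioc 0 T)
      (fun t ht => (hψ t ht.1).continuousAt.continuousWithinAt)
      (f' := fun t => (conj N * (z t / h t)).re - 3 * a / t ^ 4) ?_ ?_
    · intro t ht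
      rw [interior_Ioc] at ht
      exact (hψ t ht.1).hasDerivWithinAt
    · intro t ht
      rw [interior_Ioc] at ht
      have ht1 : t ∈ Ioc (0 : ℝ) 1 := ⟨ht.1, ht.2.le.trans hT1⟩
      have hht := hpos t ht.1
      have hht' : (h t : ℂ) ≠ 0 := Complex.ofReal_ne_zero.2 hht.ne'
      have e : (conj N * (z t / h t)).re = (conj N * (h t * z t)).re / h t ^ 2 := by
        rw [← Complex.div_ofReal_re]
        congr 1
        push_cast
        field_simp
      have e2 : (conj N * (h t * z t)).re
          = ‖N‖ ^ 2 + (conj N * (h t * z t - N)).re := by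
        rw [mul_sub, Complex.sub_re, Complex.conj_mul']
        norm_cast
        ring
      have e3 : |(conj N * (h t * z t - N)).re| ≤ ‖N‖ * (K * t ^ 2) := by
        refine (Complex.abs_re_le_norm _).trans ?_
        rw [norm_mul, Complex.norm_conj]
        exact mul_le_mul_of_nonneg_left (hN t ht1) hn.le
      have e4 : K * t ^ 2 ≤ ‖N‖ / 2 := by
        have : K * t ^ 2 ≤ K * T := mul_le_mul_of_nonneg_left (by nlinarith [ht.1, ht.2]) hK
        linarith
      have e5 : 3 * a ≤ (conj N * (h t * z t)).re := by
        rw [e2]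
        have := (abs_le.1 e3).1
        have := mul_le_mul_of_nonneg_left e4 hn.le
        rw [ha]
        nlinarith
      have e6 : h t ^ 2 ≤ t ^ 4 := by
        have := pow_le_pow_left₀ hht.le (hup t ht1) 2
        linarith [pow_mul t 2 2]
      rw [e, sub_nonneg]
      exact div_le_div₀ (by linarith) e5 (by positivity) e6
  -- Multiplying the `t⁻³` blow-up of `y / h` by `h ≥ c t²` makes `|y|` at least of order `1 / t`,
  -- which is not integrable at `0`.
  have hbound : ∀ t ∈ Ioc 0 T, t⁻¹ ≤ (a * c)⁻¹ * (‖N‖ * ‖y t‖ + |ψ T|) := by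
    intro t ht
    have ht1 : t ∈ Ioc (0 : ℝ) 1 := ⟨ht.1, ht.2.trans hT1⟩
    have hht := hpos t ht.1
    have h1 : ψ t ≤ ψ T := hmono ht ⟨hT0, le_rfl⟩ ht.2
    have h2 : -φ t ≤ ‖N‖ * (‖y t‖ / h t) := by
      have := Complex.abs_re_le_norm (conj N * (y t / h t))
      rw [norm_mul, Complex.norm_conj, norm_div, Complex.norm_real, Real.norm_eq_abs,
        abs_of_pos hht] at this
      exact (neg_le_abs _).trans this
    have h3 : a * (t ^ 3)⁻¹ ≤ ‖N‖ * (‖y t‖ / h t) + |ψ T| := by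
      have : φ t + a * (t ^ 3)⁻¹ ≤ ψ T := h1
      linarith [le_abs_self (ψ T)]
    have h4 := mul_le_mul_of_nonneg_right h3 hht.le
    have h5 : a * (t ^ 3)⁻¹ * (c * t ^ 2) ≤ a * (t ^ 3)⁻¹ * h t :=
      mul_le_mul_of_nonneg_left (hlow t ht1) (by have := ht.1; positivity)
    have h6 : a * (t ^ 3)⁻¹ * (c * t ^ 2) = a * c * t⁻¹ := by
      have := ht.1.ne'
      field_simp
    have h7 : (‖N‖ * (‖y t‖ / h t) + |ψ T|) * h t = ‖N‖ * ‖y t‖ + |ψ T| * h t := by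
      field_simp
    have h8 : |ψ T| * h t ≤ |ψ T| := by
      refine mul_le_of_le_one_right (abs_nonneg _) ((hup t ht1).trans ?_)
      exact pow_le_one₀ ht.1.le ht1.2
    rw [le_inv_mul_iff₀ (by positivity)]
    linarith
  have hinv : IntegrableOn (fun t : ℝ => t⁻¹) (Ioc 0 T) := by
    have h1 : IntegrableOn (fun t => (a * c)⁻¹ * (‖N‖ * ‖y t‖ + |ψ T|)) (Ioc 0 T) :=
      Integrable.const_mul (((hyi.mono_set (Ioc_subset_Ioc_right hT1)).norm.const_mul _).add
        (integrableOn_const (by simp) (by simp))) _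
    refine Integrable.mono' h1 measurable_inv.aestronglyMeasurable ?_
    refine (ae_restrict_iff' measurableSet_Ioc).2 (ae_of_all _ fun t ht => ?_)
    rw [Real.norm_eq_abs, abs_of_pos (inv_pos.2 ht.1)]
    exact hbound t ht
  have := intervalIntegrable_inv_iff.1
    ((intervalIntegrable_iff_integrableOn_Ioc_of_le hT0.le).2 hinv)
  rcases this with h | h
  · exact hT0.ne h
  · exact h left_mem_uIcc

/-- Integrate `(y / h)' = z / h` from `t` to `1`, using `|z / h| ≤ K / (c s²)`. -/
theorem quotient_norm_le {y z : ℝ → ℂ} {b h : ℝ → ℝ} {c K : ℝ} (hc : 0 < c) (hK : 0 ≤ K)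
    (hy : ∀ t > 0, HasDerivAt y (b t * y t + z t) t)
    (hzc : ContinuousOn z (Ioi 0))
    (hh : ∀ t > 0, HasDerivAt h (b t * h t) t) (hpos : ∀ t > 0, 0 < h t)
    (hlow : ∀ t ∈ Ioc (0 : ℝ) 1, c * t ^ 2 ≤ h t)
    (hN : ∀ t ∈ Ioc (0 : ℝ) 1, ‖z t‖ ≤ K) :
    ∀ t ∈ Ioc (0 : ℝ) 1, ‖y t / h t‖ ≤ K / c / t + ‖y 1 / h 1‖ := by
  intro t ht
  have hsub : uIcc t 1 ⊆ Ioi 0 := by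
    rw [uIcc_of_le ht.2]
    exact fun s hs => ht.1.trans_le hs.1
  have hhc : ContinuousOn h (Ioi 0) := fun t ht => (hh t ht).continuousAt.continuousWithinAt
  have hci : IntervalIntegrable (fun s => z s / h s) volume t 1 := by
    refine ContinuousOn.intervalIntegrable (ContinuousOn.mono (hzc.div
      (Complex.continuous_ofReal.comp_continuousOn hhc) fun s hs => ?_) hsub)
    exact Complex.ofReal_ne_zero.2 (hpos s hs).ne'
  have e := intervalIntegral.integral_eq_sub_of_hasDerivAt (f := fun s => y s / h s)
    (fun s hs => quotient_hasDerivAt (hy s (hsub hs)) (hh s (hsub hs)) (hpos s (hsub hs)).ne') hci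
  have hci2 : IntervalIntegrable (fun s => K / c / s ^ 2) volume t 1 := by
    refine ContinuousOn.intervalIntegrable (ContinuousOn.div continuousOn_const (by fun_prop) ?_)
    intro s hs
    exact pow_ne_zero 2 (ne_of_gt (hsub hs))
  have e2 : ∫ s in t..1, K / c / s ^ 2 = -(K / c / 1) - -(K / c / t) := by
    refine intervalIntegral.integral_eq_sub_of_hasDerivAt (f := fun s => -(K / c / s))
      (fun s hs => ?_) hci2
    have hs0 : s ≠ 0 := ne_of_gt (hsub hs)
    refine ((hasDerivAt_inv hs0).const_mul (K / c)).neg.congr_deriv ?_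
    field_simp
  have e3 : ‖∫ s in t..1, z s / h s‖ ≤ ∫ s in t..1, K / c / s ^ 2 := by
    refine intervalIntegral.norm_integral_le_of_norm_le ht.2 (ae_of_all _ fun s hs => ?_) hci2
    have hs0 : 0 < s := ht.1.trans hs.1
    rw [norm_div, Complex.norm_real, Real.norm_eq_abs, abs_of_pos (hpos s hs0), div_div]
    exact div_le_div₀ hK (hN s ⟨hs0, hs.2⟩) (by positivity) (hlow s ⟨hs0, hs.2⟩)
  rw [e, e2] at e3
  have := norm_sub_norm_le (y t / h t) (y 1 / h 1)
  rw [norm_sub_rev] at this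
  have : 0 ≤ K / c := by positivity
  linarith

/-- Behaviour at `0`: `z` is bounded and `z * conj y` vanishes. -/
theorem boundary_at_zero {y z : ℝ → ℂ} {b h : ℝ → ℝ} {lam : ℂ} {c : ℝ} (hc : 0 < c)
    (hint : IntegrableOn (fun t => ‖y t‖ ^ 2) (Ioi 0))
    (hy : ∀ t > 0, HasDerivAt y (b t * y t + z t) t)
    (hz : ∀ t > 0, HasDerivAt z (-(b t * z t) - lam * y t) t)
    (hh : ∀ t > 0, HasDerivAt h (b t * h t) t) (hpos : ∀ t > 0, 0 < h t)
    (hlow : ∀ t ∈ Ioc (0 : ℝ) 1, c * t ^ 2 ≤ h t)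
    (hup : ∀ t ∈ Ioc (0 : ℝ) 1, h t ≤ t ^ 2) :
    (∃ K, ∀ t ∈ Ioc (0 : ℝ) 1, ‖z t‖ ≤ K) ∧
      Tendsto (fun t => z t * conj (y t)) (𝓝[>] 0) (𝓝 0) := by
  have hyc : ContinuousOn y (Ioi 0) := fun t ht => (hy t ht).continuousAt.continuousWithinAt
  have hzc : ContinuousOn z (Ioi 0) := fun t ht => (hz t ht).continuousAt.continuousWithinAt
  have hyi := integrableOn_Ioc_of_sq hyc hint
  obtain ⟨N, K, hK, hN⟩ := weighted_partner_sub_le hyc hyi hz hh hpos hup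
  obtain rfl := weighted_partner_limit_eq_zero hc hK hyi hy hh hpos hlow hup hN
  have hz1 : ∀ t ∈ Ioc (0 : ℝ) 1, ‖z t‖ ≤ K / c := by
    intro t ht
    have h1 := hN t ht
    rw [sub_zero, norm_mul, Complex.norm_real, Real.norm_eq_abs, abs_of_pos (hpos t ht.1)] at h1
    have h2 := mul_le_mul_of_nonneg_right (hlow t ht) (norm_nonneg (z t))
    have ht2 : 0 < t ^ 2 := pow_pos ht.1 2
    rw [le_div_iff₀ hc]
    nlinarith
  refine ⟨⟨_, hz1⟩, ?_⟩
  have hv := quotient_norm_le hc (div_nonneg hK hc.le) hy hzc hh hpos hlow hz1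
  rw [tendsto_zero_iff_norm_tendsto_zero]
  have hlim : Tendsto (fun t : ℝ => K * (K / c / c * t + ‖y 1 / h 1‖ * t ^ 2)) (𝓝[>] 0) (𝓝 0) := by
    have : Continuous fun t : ℝ => K * (K / c / c * t + ‖y 1 / h 1‖ * t ^ 2) := by fun_prop
    have h0 := (this.tendsto 0).mono_left (nhdsWithin_le_nhds (s := Ioi 0))
    simpa using h0
  refine squeeze_zero' (Eventually.of_forall fun _ => norm_nonneg _) ?_ hlim
  filter_upwards [Ioc_mem_nhdsGT (zero_lt_one' ℝ)] with t ht
  have hht := hpos t ht.1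
  have h1 := hN t ht
  rw [sub_zero] at h1
  have hne : (h t : ℂ) ≠ 0 := Complex.ofReal_ne_zero.2 hht.ne'
  -- The first factor is `O(t²)` and the second `O(1 / t)`, so the product tends to `0`.
  have e : ‖z t * conj (y t)‖ = ‖(h t : ℂ) * z t‖ * ‖y t / h t‖ := by
    rw [← norm_mul, norm_mul, Complex.norm_conj, ← norm_mul]
    congr 1
    field_simp
  rw [e]
  calc _ ≤ (K * t ^ 2) * (K / c / c / t + ‖y 1 / h 1‖) :=
        mul_le_mul h1 (hv t ht) (norm_nonneg _) (by positivity)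
    _ = _ := by
        have := ht.1.ne'
        field_simp

/-! ### Square integrability of `z` and the identity `∫ |z|² = λ ∫ |y|²`. -/

/-- As `b` is real and enters the two equations with opposite signs, it cancels. -/
theorem product_hasDerivAt {y z : ℝ → ℂ} {b : ℝ → ℝ} {lam : ℂ} {t : ℝ}
    (hy : HasDerivAt y (b t * y t + z t) t) (hz : HasDerivAt z (-(b t * z t) - lam * y t) t) :
    HasDerivAt (fun t => z t * conj (y t))
      (((‖z t‖ ^ 2 : ℝ) : ℂ) - lam * ((‖y t‖ ^ 2 : ℝ) : ℂ)) t := by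
  have hyc : HasDerivAt (fun t => conj (y t)) (conj (b t * y t + z t)) t :=
    Complex.conjCLE.hasFDerivAt.comp_hasDerivAt t hy
  refine (hz.mul hyc).congr_deriv ?_
  push_cast
  rw [← Complex.mul_conj', ← Complex.mul_conj', map_add, map_mul, Complex.conj_ofReal]
  ring

theorem norm_sq_hasDerivAt {y z : ℝ → ℂ} {b : ℝ → ℝ} {t : ℝ}
    (hy : HasDerivAt y (b t * y t + z t) t) :
    HasDerivAt (fun t => ‖y t‖ ^ 2) (2 * (b t * ‖y t‖ ^ 2 + (z t * conj (y t)).re)) t := by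
  refine hy.norm_sq.congr_deriv ?_
  rw [Complex.inner, Complex.sq_norm, Complex.normSq_apply]
  simp
  ring

theorem not_integrableOn_Ioi_of_le {E : ℝ → ℝ} {a e : ℝ} (he : 0 < e) (h : ∀ t > a, e ≤ E t) :
    ¬ IntegrableOn E (Ioi a) := by
  intro hE
  have h1 : IntegrableOn (fun _ : ℝ => e) (Ioi a) := by
    refine Integrable.mono' hE aestronglyMeasurable_const ?_
    refine (ae_restrict_iff' measurableSet_Ioi).2 (ae_of_all _ fun t ht => ?_)
    rw [Real.norm_eq_abs, abs_of_pos he]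
    exact h t ht
  rw [integrableOn_const_iff] at h1
  simp [he.ne'] at h1

/-- A positive value of `P` would persist to infinity and bound the integrable `E` away from zero.
-/
theorem nonpos_of_monotoneOn_of_le_integrableOn {P E : ℝ → ℝ} (hP : MonotoneOn P (Ioi 0))
    (hPE : ∀ t > 0, P t ≤ E t) (hE : IntegrableOn E (Ioi 0)) : ∀ t > 0, P t ≤ 0 := by
  intro t ht
  by_contra! hpos
  refine not_integrableOn_Ioi_of_le hpos (fun s hs => ?_) (hE.mono_set (Ioi_subset_Ioi ht.le))
  exact (hP ht (ht.trans hs) (le_of_lt hs)).trans (hPE s (ht.trans hs))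

theorem monotoneOn_Ioi_of_hasDerivAt_nonneg {P P' : ℝ → ℝ} {a : ℝ}
    (h : ∀ t > a, HasDerivAt P (P' t) t) (h0 : ∀ t > a, 0 ≤ P' t) : MonotoneOn P (Ioi a) := by
  refine monotoneOn_of_hasDerivWithinAt_nonneg (convex_Ioi a)
    (fun t ht => (h t ht).continuousAt.continuousWithinAt) (f' := P') ?_ ?_
  · rw [interior_Ioi]
    exact fun t ht => (h t ht).hasDerivWithinAt
  · rw [interior_Ioi]
    exact h0

/-- If `∫ |z|²` became too large, `Re (z * conj y)` would stay above `1`. Since `b ≥ 0`, then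
`(|y|²)' ≥ 2`, contradicting `y ∈ L²`. -/
theorem partner_sq_integrableOn {y z : ℝ → ℂ} {b : ℝ → ℝ} {lam : ℂ}
    (hint : IntegrableOn (fun t => ‖y t‖ ^ 2) (Ioi 0)) (hb : ∀ t > 0, 0 ≤ b t)
    (hy : ∀ t > 0, HasDerivAt y (b t * y t + z t) t)
    (hz : ∀ t > 0, HasDerivAt z (-(b t * z t) - lam * y t) t) :
    IntegrableOn (fun t => ‖z t‖ ^ 2) (Ioi 1) := by
  have hyc : ContinuousOn y (Ioi 0) := fun t ht => (hy t ht).continuousAt.continuousWithinAt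
  have hzc : ContinuousOn z (Ioi 0) := fun t ht => (hz t ht).continuousAt.continuousWithinAt
  have hzI : ∀ s t : ℝ, 1 ≤ s → s ≤ t → IntervalIntegrable (fun t => ‖z t‖ ^ 2) volume s t := by
    intro s t hs hst
    refine ContinuousOn.intervalIntegrable ((hzc.norm.pow 2).mono fun r hr => ?_)
    rw [uIcc_of_le hst] at hr
    exact zero_lt_one.trans_le (hs.trans hr.1)
  have hyI : ∀ t : ℝ, 1 ≤ t → IntervalIntegrable (fun t => ‖y t‖ ^ 2) volume 1 t := by
    intro t ht
    refine ContinuousOn.intervalIntegrable ((hyc.norm.pow 2).mono fun r hr => ?_)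
    rw [uIcc_of_le ht] at hr
    exact zero_lt_one.trans_le hr.1
  set Y := ∫ t in Ioi (1 : ℝ), ‖y t‖ ^ 2 with hY
  -- The last two terms absorb the value at `1` and the contribution of `λ |y|²`; the remaining `1`
  -- is the lower bound for `Re (z * conj y)`.
  set I := 1 + |(z 1 * conj (y 1)).re| + ‖lam‖ * Y with hI
  by_cases hbd : ∀ T : ℝ, 1 ≤ T → ∫ t in (1 : ℝ)..T, ‖z t‖ ^ 2 ≤ I
  · refine integrableOn_Ioi_of_intervalIntegral_norm_bounded (b := fun T : ℝ => max 1 T)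
      (l := atTop) I 1 (fun T => ?_) ?_ ?_
    · exact (intervalIntegrable_iff_integrableOn_Ioc_of_le (le_max_left _ _)).1
        (hzI 1 _ le_rfl (le_max_left _ _))
    · exact tendsto_atTop_mono (fun T => le_max_right _ _) tendsto_id
    · filter_upwards with T
      simpa using hbd _ (le_max_left 1 T)
  exfalso
  push Not at hbd
  obtain ⟨T, hT1, hT⟩ := hbd
  have hF : ∀ t > T, 1 ≤ (z t * conj (y t)).re := by
    intro t ht
    have h1t : 1 ≤ t := hT1.trans (le_of_lt ht)
    have e : ∫ s in (1 : ℝ)..t, (‖z s‖ ^ 2 - lam.re * ‖y s‖ ^ 2)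
        = (z t * conj (y t)).re - (z 1 * conj (y 1)).re := by
      refine intervalIntegral.integral_eq_sub_of_hasDerivAt
        (f := fun s => (z s * conj (y s)).re) (fun s hs => ?_)
        ((hzI 1 t le_rfl h1t).sub ((hyI t h1t).const_mul _))
      rw [uIcc_of_le h1t] at hs
      have hs0 : 0 < s := zero_lt_one.trans_le hs.1
      have := Complex.reCLM.hasFDerivAt.comp_hasDerivAt s
        (product_hasDerivAt (hy s hs0) (hz s hs0))
      refine this.congr_deriv ?_
      rw [Complex.reCLM_apply, Complex.sub_re, Complex.ofReal_re, Complex.re_mul_ofReal]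
    rw [intervalIntegral.integral_sub (hzI 1 t le_rfl h1t) ((hyI t h1t).const_mul _),
      intervalIntegral.integral_const_mul] at e
    have h2 : ∫ s in (1 : ℝ)..T, ‖z s‖ ^ 2 ≤ ∫ s in (1 : ℝ)..t, ‖z s‖ ^ 2 :=
      intervalIntegral.integral_mono_interval le_rfl hT1 (le_of_lt ht)
        (ae_of_all _ fun _ => by positivity) (hzI 1 t le_rfl h1t)
    have h3 : ∫ s in (1 : ℝ)..t, ‖y s‖ ^ 2 ≤ Y := by
      rw [intervalIntegral.integral_of_le h1t]
      exact setIntegral_mono_set (hint.mono_set (Ioi_subset_Ioi zero_le_one))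
        (ae_of_all _ fun _ => by positivity) Ioc_subset_Ioi_self.eventuallyLE
    have h4 : 0 ≤ ∫ s in (1 : ℝ)..t, ‖y s‖ ^ 2 :=
      intervalIntegral.integral_nonneg h1t fun _ _ => by positivity
    have h5 : lam.re * ∫ s in (1 : ℝ)..t, ‖y s‖ ^ 2 ≤ ‖lam‖ * Y :=
      mul_le_mul (Complex.re_le_norm _) h3 h4 (norm_nonneg _)
    have := neg_abs_le (z 1 * conj (y 1)).re
    linarith
  have hT0 : 0 < T := zero_lt_one.trans_le hT1
  have hmono : MonotoneOn (fun t => ‖y t‖ ^ 2 - 2 * t) (Ioi T) := by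
    refine monotoneOn_Ioi_of_hasDerivAt_nonneg (fun t ht =>
      (norm_sq_hasDerivAt (hy t (hT0.trans ht))).sub ((hasDerivAt_id t).const_mul 2)) ?_
    intro t ht
    have h1 := hF t ht
    have h2 := mul_nonneg (hb t (hT0.trans ht)) (sq_nonneg ‖y t‖)
    linarith
  refine not_integrableOn_Ioi_of_le (a := T + 2) zero_lt_one (fun t ht => ?_)
    (hint.mono_set (Ioi_subset_Ioi (by linarith)))
  have ht2 : T + 2 < t := ht
  -- Monotonicity holds on the open ray past `T`, so compare with `T + 1`; for `t > T + 2` the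
  -- linear growth already exceeds `1`.
  have h1 := hmono (a := T + 1) (b := t) (by simp) (by simp only [mem_Ioi]; linarith) (by linarith)
  simp only at h1
  nlinarith [sq_nonneg ‖y (T + 1)‖]

/-- At infinity the boundary term vanishes because `z * conj y` and its derivative are both
integrable; at `0` this is `hlim`. -/
theorem integral_partner_sq_eq {y z : ℝ → ℂ} {b : ℝ → ℝ} {lam : ℂ}
    (hint : IntegrableOn (fun t => ‖y t‖ ^ 2) (Ioi 0))
    (hzint : IntegrableOn (fun t => ‖z t‖ ^ 2) (Ioi 0))
    (hy : ∀ t > 0, HasDerivAt y (b t * y t + z t) t)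
    (hz : ∀ t > 0, HasDerivAt z (-(b t * z t) - lam * y t) t)
    (hlim : Tendsto (fun t => z t * conj (y t)) (𝓝[>] 0) (𝓝 0)) :
    ((∫ t in Ioi (0 : ℝ), ‖z t‖ ^ 2 : ℝ) : ℂ) = lam * ((∫ t in Ioi (0 : ℝ), ‖y t‖ ^ 2 : ℝ) : ℂ) := by
  set F : ℝ → ℂ := fun t => z t * conj (y t) with hF
  have hderiv : ∀ t ∈ Ioi (0 : ℝ),
      HasDerivAt F (((‖z t‖ ^ 2 : ℝ) : ℂ) - lam * ((‖y t‖ ^ 2 : ℝ) : ℂ)) t :=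
    fun t ht => product_hasDerivAt (hy t ht) (hz t ht)
  have hFc : ContinuousOn F (Ioi 0) := fun t ht => (hderiv t ht).continuousAt.continuousWithinAt
  have hFint : IntegrableOn F (Ioi 0) := by
    refine Integrable.mono' (hzint.add hint) (hFc.aestronglyMeasurable measurableSet_Ioi) ?_
    refine ae_of_all _ fun t => ?_
    simp only [hF, norm_mul, Complex.norm_conj, Pi.add_apply]
    nlinarith [sq_nonneg (‖z t‖ - ‖y t‖), sq_nonneg (‖z t‖ + ‖y t‖)]
  have hyC : IntegrableOn (fun t => lam * ((‖y t‖ ^ 2 : ℝ) : ℂ)) (Ioi 0) :=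
    hint.ofReal.const_mul lam
  have hzC : IntegrableOn (fun t => ((‖z t‖ ^ 2 : ℝ) : ℂ)) (Ioi 0) := hzint.ofReal
  have hF'int : IntegrableOn
      (fun t => ((‖z t‖ ^ 2 : ℝ) : ℂ) - lam * ((‖y t‖ ^ 2 : ℝ) : ℂ)) (Ioi 0) := hzC.sub hyC
  have htop := tendsto_zero_of_hasDerivAt_of_integrableOn_Ioi hderiv hF'int hFint
  -- The value of `F` at `0` is arbitrary; replacing it by the limit `0` gives the one-sided
  -- continuity needed there.
  have e := integral_Ioi_of_hasDerivAt_of_tendsto (f := Function.update F 0 0) (a := 0)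
    (continuousWithinAt_update_same.2 (by simpa [Ici_sdiff_left] using hlim))
    (fun t ht => (hderiv t ht).congr_of_eventuallyEq ?_) hF'int
    (htop.congr' ?_)
  · rw [Function.update_self, sub_zero, integral_sub hzC hyC,
      integral_const_mul, integral_complex_ofReal, integral_complex_ofReal, sub_eq_zero] at e
    exact e
  · filter_upwards [Ioi_mem_nhds ht] with s hs
    exact Function.update_of_ne (ne_of_gt hs) _ _
  · filter_upwards [Ioi_mem_atTop 0] with s hs
    exact (Function.update_of_ne (ne_of_gt hs) _ _).symm

/-! ### Nonexistence for the first-order system. -/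

/-- For `lam = μ ≥ 0` the energy `(|z|² + μ |y|²) h²` is nondecreasing. -/
theorem eq_zero_of_nonneg_eigenvalue {y z : ℝ → ℂ} {b h : ℝ → ℝ} {μ : ℝ} (hμ : 0 ≤ μ)
    (hint : IntegrableOn (fun t => ‖y t‖ ^ 2) (Ioi 0))
    (hzint : IntegrableOn (fun t => ‖z t‖ ^ 2) (Ioi 0)) (hb : ∀ t > 0, 0 ≤ b t)
    (hy : ∀ t > 0, HasDerivAt y (b t * y t + z t) t)
    (hz : ∀ t > 0, HasDerivAt z (-(b t * z t) - μ * y t) t)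
    (hh : ∀ t > 0, HasDerivAt h (b t * h t) t) (hpos : ∀ t > 0, 0 < h t)
    (hle : ∀ t > 0, h t ≤ 1) : ∀ t > 0, y t = 0 := by
  have hmono : MonotoneOn (fun t => (‖z t‖ ^ 2 + μ * ‖y t‖ ^ 2) * h t ^ 2) (Ioi 0) := by
    refine monotoneOn_Ioi_of_hasDerivAt_nonneg (P' := fun t => 4 * b t * h t ^ 2 * (μ * ‖y t‖ ^ 2))
      (fun t ht => ?_) (fun t ht => ?_)
    · refine (((hz t ht).norm_sq.add ((hy t ht).norm_sq.const_mul μ)).mul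
        ((hh t ht).pow 2)).congr_deriv ?_
      simp only [Complex.inner, Complex.sq_norm, Complex.normSq_apply]
      simp
      ring
    · have := hb t ht
      positivity
  have hE := nonpos_of_monotoneOn_of_le_integrableOn hmono
    (E := fun t => ‖z t‖ ^ 2 + μ * ‖y t‖ ^ 2)
    (fun t ht => mul_le_of_le_one_right (by positivity)
      (pow_le_one₀ (hpos t ht).le (hle t ht))) (hzint.add (hint.const_mul μ))
  have hE0 : ∀ t > 0, ‖z t‖ ^ 2 + μ * ‖y t‖ ^ 2 ≤ 0 := fun t ht =>
    nonpos_of_mul_nonpos_left (hE t ht) (pow_pos (hpos t ht) 2)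
  -- For `μ = 0` the energy controls only `z`; then `y' = b y`, so `|y|²` is itself nondecreasing
  -- and integrable.
  rcases hμ.eq_or_lt with rfl | hμ
  · have hz0 : ∀ t > 0, z t = 0 := fun t ht => by
      have := hE0 t ht
      rw [zero_mul, add_zero] at this
      exact norm_eq_zero.1 (pow_eq_zero_iff two_ne_zero |>.1 (le_antisymm this (by positivity)))
    have hm : MonotoneOn (fun t => ‖y t‖ ^ 2) (Ioi 0) := by
      refine monotoneOn_Ioi_of_hasDerivAt_nonneg (fun t ht => norm_sq_hasDerivAt (hy t ht)) ?_
      intro t ht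
      have := hb t ht
      rw [hz0 t ht, zero_mul, Complex.zero_re, add_zero]
      positivity
    intro t ht
    have := nonpos_of_monotoneOn_of_le_integrableOn hm (fun _ _ => le_rfl) hint t ht
    exact norm_eq_zero.1 (pow_eq_zero_iff two_ne_zero |>.1 (le_antisymm this (by positivity)))
  · intro t ht
    have h1 := hE0 t ht
    have h2 : ‖y t‖ ^ 2 ≤ 0 := by
      refine nonpos_of_mul_nonpos_right (a := μ) ?_ hμ
      nlinarith [sq_nonneg ‖z t‖]
    exact norm_eq_zero.1 (pow_eq_zero_iff two_ne_zero |>.1 (le_antisymm h2 (by positivity)))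

/-- The first-order system `y' = b y + z`, `z' = -b z - lam y` with `b = h' / h` and `h ~ t²` at
`0` has no nonzero solution with `y ∈ L²(0, ∞)`. -/
theorem eq_zero_of_sq_integrable {y z : ℝ → ℂ} {b h : ℝ → ℝ} {lam : ℂ} {c : ℝ} (hc : 0 < c)
    (hint : IntegrableOn (fun t => ‖y t‖ ^ 2) (Ioi 0)) (hb : ∀ t > 0, 0 ≤ b t)
    (hy : ∀ t > 0, HasDerivAt y (b t * y t + z t) t)
    (hz : ∀ t > 0, HasDerivAt z (-(b t * z t) - lam * y t) t)
    (hh : ∀ t > 0, HasDerivAt h (b t * h t) t) (hpos : ∀ t > 0, 0 < h t)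
    (hle : ∀ t > 0, h t ≤ 1) (hlow : ∀ t ∈ Ioc (0 : ℝ) 1, c * t ^ 2 ≤ h t)
    (hup : ∀ t ∈ Ioc (0 : ℝ) 1, h t ≤ t ^ 2) : ∀ t > 0, y t = 0 := by
  have hyc : ContinuousOn y (Ioi 0) := fun t ht => (hy t ht).continuousAt.continuousWithinAt
  have hzc : ContinuousOn z (Ioi 0) := fun t ht => (hz t ht).continuousAt.continuousWithinAt
  obtain ⟨⟨K, hK⟩, hlim⟩ := boundary_at_zero hc hint hy hz hh hpos hlow hup
  have hzint : IntegrableOn (fun t => ‖z t‖ ^ 2) (Ioi 0) := by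
    rw [← Ioc_union_Ioi_eq_Ioi zero_le_one]
    refine IntegrableOn.union ?_ (partner_sq_integrableOn hint hb hy hz)
    refine Integrable.mono' (g := fun _ => K ^ 2) (integrableOn_const (by simp) (by simp))
      (((hzc.norm.pow 2).mono Ioc_subset_Ioi_self).aestronglyMeasurable measurableSet_Ioc) ?_
    refine (ae_restrict_iff' measurableSet_Ioc).2 (ae_of_all _ fun t ht => ?_)
    rw [Real.norm_eq_abs, abs_of_nonneg (by positivity)]
    exact pow_le_pow_left₀ (norm_nonneg _) (hK t ht) 2
  have e := integral_partner_sq_eq hint hzint hy hz hlim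
  have hz0 : 0 ≤ ∫ t in Ioi (0 : ℝ), ‖z t‖ ^ 2 := integral_nonneg fun _ => by positivity
  have hy0 : 0 ≤ ∫ t in Ioi (0 : ℝ), ‖y t‖ ^ 2 := integral_nonneg fun _ => by positivity
  by_cases hY : ∫ t in Ioi (0 : ℝ), ‖y t‖ ^ 2 = 0
  · have hae := (setIntegral_eq_zero_iff_of_nonneg_ae (ae_of_all _ fun _ => by positivity) hint).1 hY
    have heq := Measure.eqOn_open_of_ae_eq hae isOpen_Ioi (hyc.norm.pow 2) continuousOn_const
    exact fun t ht => norm_eq_zero.1 (pow_eq_zero_iff two_ne_zero |>.1 (heq ht))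
  · have hlam : lam = (((∫ t in Ioi (0 : ℝ), ‖z t‖ ^ 2) / ∫ t in Ioi (0 : ℝ), ‖y t‖ ^ 2 : ℝ) : ℂ) := by
      rw [Complex.ofReal_div, e, mul_div_cancel_right₀]
      exact Complex.ofReal_ne_zero.2 hY
    rw [hlam] at hz
    exact eq_zero_of_nonneg_eigenvalue (div_nonneg hz0 hy0) hint hzint hb hy hz hh hpos hle

/-! ### Classical regularity from an a.e. equation. -/

/-- A locally absolutely continuous function whose derivative agrees a.e. with a continuous
function is continuously differentiable. -/
theorem ACloc.hasDerivAt_of_ae_eq {f g : ℝ → ℂ} (hf : ACloc f) (hg : ContinuousOn g (Ioo 0 1))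
    (h : ∀ᵐ x, x ∈ Ioo (0 : ℝ) 1 → deriv f x = g x) {x : ℝ} (hx : x ∈ Ioo (0 : ℝ) 1) :
    HasDerivAt f (g x) x := by
  obtain ⟨a, h0a, hax⟩ := exists_between hx.1
  obtain ⟨b, hxb, hb1⟩ := exists_between hx.2
  have hab : a ≤ b := (hax.trans hxb).le
  have hsub : Icc a b ⊆ Ioo 0 1 := fun y hy => ⟨h0a.trans_le hy.1, hy.2.trans_lt hb1⟩
  have hG : ∀ y ∈ Ioo (0 : ℝ) 1, HasDerivAt (fun z => ∫ t in a..z, g t) (g y) y := by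
    intro y hy
    refine intervalIntegral.integral_hasDerivAt_right ?_ ?_ (hg.continuousAt (Ioo_mem_nhds hy.1 hy.2))
    · refine (hg.mono fun t ht => ?_).intervalIntegrable
      exact ordConnected_Ioo.uIcc_subset ⟨h0a, hab.trans_lt hb1⟩ hy ht
    · exact hg.stronglyMeasurableAtFilter isOpen_Ioo y hy
  have hGac : AbsolutelyContinuousOnInterval (fun z => ∫ t in a..z, g t) a b := by
    have hcd : ContDiffOn ℝ 1 (fun z => ∫ t in a..z, g t) (Ioo 0 1) := by
      rw [show (1 : WithTop ℕ∞) = 0 + 1 from rfl, contDiffOn_succ_iff_deriv_of_isOpen isOpen_Ioo]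
      refine ⟨fun y hy => (hG y hy).differentiableAt.differentiableWithinAt, by simp, ?_⟩
      exact contDiffOn_zero.2 (hg.congr fun y hy => (hG y hy).deriv)
    exact (hcd.mono (by rw [uIcc_of_le hab]; exact hsub)).absolutelyContinuousOnInterval
  obtain ⟨C, hC⟩ := ((hf a b h0a hab hb1).sub hGac).const_of_ae_hasDerivAt_zero (by
    filter_upwards [hf.ae_differentiableAt, h] with y hy hyg hyab
    rw [uIcc_of_le hab] at hyab
    have hy01 := hsub hyab
    have := (hy hy01).hasDerivAt.sub (hG y hy01)
    rwa [hyg hy01, sub_self] at this)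
  have hEq : f =ᶠ[𝓝 x] fun z => C + ∫ t in a..z, g t := by
    filter_upwards [Icc_mem_nhds hax hxb] with z hz
    have := hC z (by rw [uIcc_of_le hab]; exact hz)
    simp only [Pi.sub_apply] at this
    rw [← this]
    ring
  exact ((hG x hx).const_add C).congr_of_eventuallyEq hEq

/-! ### The substitution `ρ = tanh t` and the zero-energy solution. -/

theorem hasDerivAt_real_tanh (t : ℝ) : HasDerivAt Real.tanh (Real.cosh t ^ 2)⁻¹ t := by
  have hc := (Real.cosh_pos t).ne'
  have h : Real.tanh = fun t => Real.sinh t / Real.cosh t := funext Real.tanh_eq_sinh_div_cosh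
  rw [h]
  refine ((Real.hasDerivAt_sinh t).div (Real.hasDerivAt_cosh t) hc).congr_deriv ?_
  rw [inv_eq_one_div, ← Real.cosh_sq_sub_sinh_sq t]
  ring

theorem tanh_image_Ioi : Real.tanh '' Ioi 0 = Ioo 0 1 := by
  ext x
  constructor
  · rintro ⟨t, ht, rfl⟩
    have hs : 0 < Real.sinh t := Real.sinh_pos_iff.2 ht
    rw [Real.tanh_eq_sinh_div_cosh]
    exact ⟨div_pos hs (Real.cosh_pos t), (div_lt_one (Real.cosh_pos t)).2 (Real.sinh_lt_cosh t)⟩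
  · exact fun hx => ⟨Real.artanh x, Real.artanh_pos hx,
      Real.tanh_artanh ⟨by linarith [hx.1], hx.2⟩⟩

theorem tanh_mem_Ioo {t : ℝ} (ht : 0 < t) : Real.tanh t ∈ Ioo (0 : ℝ) 1 :=
  tanh_image_Ioi ▸ mem_image_of_mem _ ht

theorem weight_tanh (t : ℝ) : weight (Real.tanh t) = Real.sinh t ^ 2 * Real.cosh t ^ 2 := by
  have hc := (Real.cosh_pos t).ne'
  have h : 1 - Real.tanh t ^ 2 = (Real.cosh t ^ 2)⁻¹ := by
    rw [Real.tanh_eq_sinh_div_cosh]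
    field_simp
    linarith [Real.cosh_sq t]
  rw [weight, h, Real.tanh_eq_sinh_div_cosh]
  field_simp

theorem g0_tanh {t : ℝ} (ht : 0 < t) :
    g0 (Real.tanh t) = 1 - 2 * (Real.sinh t / Real.cosh t) ^ 2
      - 16 * Real.cosh t ^ 2 / (Real.cosh t ^ 2 + Real.sinh t ^ 2) ^ 2 := by
  have hc := Real.cosh_pos t
  have hs : 0 < Real.sinh t := Real.sinh_pos_iff.2 ht
  have h1 : 1 - Real.tanh t ^ 2 = (Real.cosh t ^ 2)⁻¹ := by
    rw [Real.tanh_eq_sinh_div_cosh]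
    field_simp
    linarith [Real.cosh_sq t]
  have h2 : 1 + Real.tanh t ^ 2 = (Real.cosh t ^ 2 + Real.sinh t ^ 2) / Real.cosh t ^ 2 := by
    rw [Real.tanh_eq_sinh_div_cosh]
    field_simp
  have h0 : Real.tanh t ≠ 0 := (tanh_mem_Ioo ht).1.ne'
  have h3 : (1 : ℝ) + Real.tanh t ^ 2 ≠ 0 := by positivity
  have e : g0 (Real.tanh t) = 1 - 2 * Real.tanh t ^ 2
      - 16 * (1 - Real.tanh t ^ 2) / (1 + Real.tanh t ^ 2) ^ 2 := by
    rw [g0, cos_two_f0]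
    field_simp
    ring
  rw [e, h1, h2, Real.tanh_eq_sinh_div_cosh]
  field_simp

/-- The zero-energy solution `sinh² t / cosh 2t`. -/
noncomputable def groundState (t : ℝ) : ℝ :=
  Real.sinh t ^ 2 / (Real.cosh t ^ 2 + Real.sinh t ^ 2)

/-- The logarithmic derivative of `groundState`. -/
noncomputable def superpotential (t : ℝ) : ℝ :=
  2 * Real.cosh t / (Real.sinh t * (Real.cosh t ^ 2 + Real.sinh t ^ 2))

theorem groundState_hasDerivAt {t : ℝ} (ht : 0 < t) :
    HasDerivAt groundState (superpotential t * groundState t) t := by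
  have hc := Real.cosh_pos t
  have hs : 0 < Real.sinh t := Real.sinh_pos_iff.2 ht
  have hsd := (Real.hasDerivAt_sinh t).pow 2
  have hD : Real.cosh t ^ 2 + Real.sinh t ^ 2 ≠ 0 := by positivity
  refine (hsd.div (((Real.hasDerivAt_cosh t).pow 2).add hsd) hD).congr_deriv ?_
  simp only [superpotential, groundState, Pi.add_apply, Pi.pow_apply]
  push_cast
  field_simp
  rw [Real.cosh_sq]
  ring

theorem groundState_pos {t : ℝ} (ht : 0 < t) : 0 < groundState t := by
  have hs : 0 < Real.sinh t := Real.sinh_pos_iff.2 ht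
  unfold groundState
  positivity

theorem superpotential_nonneg {t : ℝ} (ht : 0 < t) : 0 ≤ superpotential t := by
  have hs : 0 < Real.sinh t := Real.sinh_pos_iff.2 ht
  have hc := Real.cosh_pos t
  unfold superpotential
  positivity

theorem groundState_le_one (t : ℝ) : groundState t ≤ 1 := by
  have hc := Real.cosh_pos t
  unfold groundState
  rw [div_le_one (by positivity)]
  nlinarith

theorem sinh_le_mul_cosh {t : ℝ} (ht : 0 ≤ t) : Real.sinh t ≤ t * Real.cosh t := by
  have hmono : MonotoneOn (fun t => t * Real.cosh t - Real.sinh t) (Ici 0) := by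
    have hd : ∀ s : ℝ, HasDerivAt (fun t => t * Real.cosh t - Real.sinh t) (s * Real.sinh s) s := by
      intro s
      refine (((hasDerivAt_id s).mul (Real.hasDerivAt_cosh s)).sub
        (Real.hasDerivAt_sinh s)).congr_deriv ?_
      simp
    refine monotoneOn_of_hasDerivWithinAt_nonneg (convex_Ici 0)
      (fun s _ => (hd s).continuousAt.continuousWithinAt)
      (fun s _ => (hd s).hasDerivWithinAt) fun s hs => ?_
    rw [interior_Ici] at hs
    exact mul_nonneg (le_of_lt hs) (Real.sinh_nonneg_iff.2 (le_of_lt hs))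
  have := hmono self_mem_Ici ht ht
  simpa using this

/-- From `sinh t ≤ t cosh t`: the numerator is at most `t² cosh² t`. -/
theorem groundState_le_sq {t : ℝ} (ht : 0 < t) : groundState t ≤ t ^ 2 := by
  have hc := Real.cosh_pos t
  have hs : 0 < Real.sinh t := Real.sinh_pos_iff.2 ht
  have h := pow_le_pow_left₀ hs.le (sinh_le_mul_cosh ht.le) 2
  unfold groundState
  rw [div_le_iff₀ (by positivity)]
  nlinarith [mul_nonneg (sq_nonneg t) (sq_nonneg (Real.sinh t))]

/-- The numerator is at least `t²`, and the denominator on `(0, 1]` is at most its value at `1`. -/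
theorem le_groundState {t : ℝ} (ht : t ∈ Ioc (0 : ℝ) 1) :
    (Real.cosh 1 ^ 2 + Real.sinh 1 ^ 2)⁻¹ * t ^ 2 ≤ groundState t := by
  have hc := Real.cosh_pos t
  have h1 : t ≤ Real.sinh t := Real.self_le_sinh_iff.2 ht.1.le
  have h2 : Real.sinh t ≤ Real.sinh 1 := Real.sinh_le_sinh.2 ht.2
  have h3 := pow_le_pow_left₀ (ht.1.le.trans h1) h2 2
  have h4 := Real.cosh_sq t
  have h5 := Real.cosh_sq 1
  unfold groundState
  rw [inv_mul_eq_div]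
  exact div_le_div₀ (by positivity) (pow_le_pow_left₀ ht.1.le h1 2) (by positivity) (by linarith)

/-! ### The transformed eigenvalue equation. -/

/-- The Liouville transform `sinh t * f (tanh t)`. -/
noncomputable def liouville (f : ℝ → ℂ) (t : ℝ) : ℂ := Real.sinh t * f (Real.tanh t)

/-- The supersymmetric partner of `liouville f`. -/
noncomputable def partner (f : ℝ → ℂ) (t : ℝ) : ℂ :=
  ((Real.cosh t - 2 * Real.cosh t / (Real.cosh t ^ 2 + Real.sinh t ^ 2) : ℝ) : ℂ) * f (Real.tanh t)
    + ((Real.sinh t)⁻¹ : ℝ) * quasiDeriv f (Real.tanh t)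

theorem comp_tanh_hasDerivAt {f : ℝ → ℂ} {t : ℝ} (ht : 0 < t)
    (hf : DifferentiableAt ℝ f (Real.tanh t)) :
    HasDerivAt (fun t => f (Real.tanh t))
      (((Real.sinh t ^ 2)⁻¹ : ℝ) * quasiDeriv f (Real.tanh t)) t := by
  have hc := (Complex.ofReal_ne_zero (z := Real.cosh t)).2 (Real.cosh_pos t).ne'
  have hs := (Complex.ofReal_ne_zero (z := Real.sinh t)).2 (Real.sinh_pos_iff.2 ht).ne'
  refine (hf.hasDerivAt.scomp t (hasDerivAt_real_tanh t)).congr_deriv ?_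
  rw [quasiDeriv, Complex.real_smul, Real.tanh_eq_sinh_div_cosh]
  push_cast at hc hs ⊢
  field_simp

theorem liouville_hasDerivAt {f : ℝ → ℂ} {t : ℝ} (ht : 0 < t)
    (hf : DifferentiableAt ℝ f (Real.tanh t)) :
    HasDerivAt (liouville f) (superpotential t * liouville f t + partner f t) t := by
  have hs := (Complex.ofReal_ne_zero (z := Real.sinh t)).2 (Real.sinh_pos_iff.2 ht).ne'
  have hD : Real.cosh t ^ 2 + Real.sinh t ^ 2 ≠ 0 := by
    have := Real.cosh_pos t
    positivity
  have hD' := Complex.ofReal_ne_zero.2 hD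
  refine ((Real.hasDerivAt_sinh t).ofReal_comp.mul (comp_tanh_hasDerivAt ht hf)).congr_deriv ?_
  simp only [liouville, partner, superpotential]
  push_cast at hs hD' ⊢
  field_simp
  ring

/-- This is where the specific `g₀` enters: the transformed potential equals `b' + b²`. As `partner`
involves only `f` and `p f'`, the equation for `p f'` suffices. -/
theorem partner_hasDerivAt {f : ℝ → ℂ} {lam : ℂ} {t : ℝ} (ht : 0 < t)
    (hf : DifferentiableAt ℝ f (Real.tanh t))
    (hq : HasDerivAt (quasiDeriv f)
      ((2 + weight (Real.tanh t) * (g0 (Real.tanh t) - lam)) * f (Real.tanh t)) (Real.tanh t)) :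
    HasDerivAt (partner f) (-(superpotential t * partner f t) - lam * liouville f t) t := by
  have hc0 := Real.cosh_pos t
  have hs0 : 0 < Real.sinh t := Real.sinh_pos_iff.2 ht
  have hD0 : Real.cosh t ^ 2 + Real.sinh t ^ 2 ≠ 0 := by positivity
  have hc := Complex.ofReal_ne_zero.2 hc0.ne'
  have hs := Complex.ofReal_ne_zero.2 hs0.ne'
  have hD := Complex.ofReal_ne_zero.2 hD0
  have hcs : (Real.cosh t : ℂ) ^ 2 = (Real.sinh t : ℂ) ^ 2 + 1 := by
    exact_mod_cast Real.cosh_sq t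
  have hcoef : HasDerivAt
      (fun t => Real.cosh t - 2 * Real.cosh t / (Real.cosh t ^ 2 + Real.sinh t ^ 2)) _ t :=
    (Real.hasDerivAt_cosh t).sub (((Real.hasDerivAt_cosh t).const_mul 2).div
      (((Real.hasDerivAt_cosh t).pow 2).add ((Real.hasDerivAt_sinh t).pow 2)) hD0)
  have hinv := (Real.hasDerivAt_sinh t).inv hs0.ne'
  have hqd := hq.scomp t (hasDerivAt_real_tanh t)
  refine ((hcoef.ofReal_comp.mul (comp_tanh_hasDerivAt ht hf)).add
    (hinv.ofReal_comp.mul hqd)).congr_deriv ?_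
  rw [g0_tanh ht, weight_tanh, Complex.real_smul]
  simp only [liouville, partner, superpotential, Pi.inv_apply, Function.comp_apply]
  -- What remains is a rational identity in `C = cosh t` and `S = sinh t` modulo `C² = S² + 1`,
  -- linear in `F` and `Q`.
  generalize f (Real.tanh t) = F
  generalize quasiDeriv f (Real.tanh t) = Q
  generalize Real.cosh t = C at *
  generalize Real.sinh t = S at *
  push_cast at hD ⊢
  generalize (C : ℂ) = C at *
  generalize (S : ℂ) = S at *
  field_simp
  grind

/-! ### From eigenvectors of `A₀` to the first-order system. -/

theorem opA0_ae_eq (u : opA0.domain) :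
    opA0 u =ᵐ[weightMeasure] fun ρ => slExpr (rep u) ρ + g0 ρ * rep u ρ := by
  have e : opA0 u = (rep_inDomain u).memLp_slExpr.toLp (slExpr (rep u))
      + (memLp_g0_mul (u : H)).toLp _ := rfl
  rw [e]
  filter_upwards [Lp.coeFn_add ((rep_inDomain u).memLp_slExpr.toLp (slExpr (rep u)))
    ((memLp_g0_mul (u : H)).toLp _), (rep_inDomain u).memLp_slExpr.coeFn_toLp,
    (memLp_g0_mul (u : H)).coeFn_toLp, rep_ae_eq u] with ρ h1 h2 h3 h4
  rw [h1, Pi.add_apply, h2, h3, h4]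

/-- An eigenfunction satisfies the differential equation classically on `(0, 1)`. -/
theorem quasiDeriv_hasDerivAt_of_eigen {u : opA0.domain} {lam : ℂ} (h : opA0 u = lam • (u : H))
    {ρ : ℝ} (hρ : ρ ∈ Ioo (0 : ℝ) 1) :
    HasDerivAt (quasiDeriv (rep u)) ((2 + weight ρ * (g0 ρ - lam)) * rep u ρ) ρ := by
  have hu := rep_inDomain u
  refine hu.ac_quasiDeriv.hasDerivAt_of_ae_eq
    (g := fun ρ => (2 + weight ρ * (g0 ρ - lam)) * rep u ρ) ?_ ?_ hρ
  · have hw : ContinuousOn weight (Ioo 0 1) := by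
      refine ContinuousOn.div (by fun_prop) (by fun_prop) fun x hx => ?_
      have : 0 < 1 - x ^ 2 := by nlinarith [hx.1, hx.2]
      positivity
    have hg : ContinuousOn g0 (Ioo 0 1) := by
      have := Real.continuous_arctan
      refine ContinuousOn.div (Continuous.continuousOn ?_) (by fun_prop) fun x hx =>
        pow_ne_zero 2 hx.1.ne'
      unfold f0
      fun_prop
    have hw' := Complex.continuous_ofReal.comp_continuousOn hw
    have hg' := Complex.continuous_ofReal.comp_continuousOn hg
    exact (continuousOn_const.add (hw'.mul (hg'.sub continuousOn_const))).mul hu.ac.continuousOn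
  · have hae : ∀ᵐ ρ ∂weightMeasure, slExpr (rep u) ρ + g0 ρ * rep u ρ = lam * rep u ρ := by
      filter_upwards [opA0_ae_eq u, Lp.coeFn_smul lam (u : H), rep_ae_eq u] with x h1 h2 h3
      rw [← h1, h, h2, Pi.smul_apply, h3, smul_eq_mul]
    have hae' := (ae_restrict_iff' measurableSet_Ioo).1 (restrict_absolutelyContinuous.ae_le hae)
    filter_upwards [hae'] with x hx hx01
    have hw : (weight x : ℂ) ≠ 0 := Complex.ofReal_ne_zero.2 (weight_pos hx01).ne'
    have h1 := hx hx01
    rw [slExpr] at h1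
    field_simp at h1
    linear_combination -h1

/-- The weight `sinh² cosh²` times the Jacobian `1 / cosh²` is `sinh²`, the square of the prefactor
in `liouville`. -/
theorem liouville_sq_integrableOn {f : ℝ → ℂ} (hf : MemLp f 2 weightMeasure) :
    IntegrableOn (fun t => ‖liouville f t‖ ^ 2) (Ioi 0) := by
  have h1 : Integrable (fun ρ => ‖f ρ‖ ^ 2) weightMeasure := hf.integrable_norm_pow two_ne_zero
  rw [weightMeasure, integrable_withDensity_iff measurable_weight.ennreal_ofReal
    (ae_of_all _ fun _ => ENNReal.ofReal_lt_top)] at h1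
  rw [← IntegrableOn, ← tanh_image_Ioi, integrableOn_image_iff_integrableOn_abs_deriv_smul
    measurableSet_Ioi (fun t _ => (hasDerivAt_real_tanh t).hasDerivWithinAt)
    Real.tanh_injective.injOn] at h1
  refine h1.congr_fun (fun t ht => ?_) measurableSet_Ioi
  have hc := Real.cosh_pos t
  have hs : 0 < Real.sinh t := Real.sinh_pos_iff.2 ht
  have hw := (weight_pos (tanh_mem_Ioo ht)).le
  simp only [liouville]
  rw [ENNReal.toReal_ofReal hw, weight_tanh, norm_mul, Complex.norm_real, Real.norm_eq_abs,
    abs_of_pos hs, abs_of_nonneg (by positivity), smul_eq_mul]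
  field_simp

theorem pointSpectrum_opA0_eq_empty : pointSpectrum opA0 = ∅ := by
  rw [eq_empty_iff_forall_notMem]
  rintro lam ⟨u, hu0, hu⟩
  have hdom := rep_inDomain u
  have hdiff : ∀ t > 0, DifferentiableAt ℝ (rep u) (Real.tanh t) := fun t ht =>
    hdom.ac.differentiableAt hdom.ac_quasiDeriv (tanh_mem_Ioo ht)
  have hzero := eq_zero_of_sq_integrable (c := (Real.cosh 1 ^ 2 + Real.sinh 1 ^ 2)⁻¹)
    (by have := Real.cosh_pos 1; positivity) (liouville_sq_integrableOn hdom.memLp)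
    (fun t ht => superpotential_nonneg ht) (fun t ht => liouville_hasDerivAt ht (hdiff t ht))
    (fun t ht => partner_hasDerivAt ht (hdiff t ht)
      (quasiDeriv_hasDerivAt_of_eigen hu (tanh_mem_Ioo ht)))
    (fun t ht => groundState_hasDerivAt ht) (fun t ht => groundState_pos ht)
    (fun t _ => groundState_le_one t) (fun t ht => le_groundState ht)
    (fun t ht => groundState_le_sq ht.1)
  refine hu0 (Lp.ext ((rep_ae_eq u).trans (.trans ?_ (Lp.coeFn_zero _ _ _).symm)))
  refine ae_of_forall_mem fun ρ hρ => ?_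
  obtain ⟨t, ht, rfl⟩ := tanh_image_Ioi ▸ hρ
  have hs : (Real.sinh t : ℂ) ≠ 0 := Complex.ofReal_ne_zero.2 (Real.sinh_pos_iff.2 ht).ne'
  exact (mul_eq_zero.1 (hzero t ht)).resolve_left hs

end WaveMap

theorem mainTheorem7 : WaveMap.pointSpectrum WaveMap.opA0 = ∅ :=
  WaveMap.pointSpectrum_opA0_eq_empty
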